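/- Let $G=\prod_{j=0}^{\infty}\mathbb Z_2$ be the dyadic group, with its normalized Haar measure $\mu$ (the product of the uniform probability measures on $\mathbb Z_2=\{0,1\}$). For $n\in\mathbb N=\{0,1,2,\dots\}$ and $x\in G$ let $I_n(x)=\{y\in G: y_i=x_i \text{ for all } i<n\}$, and let $\zeta_n$ be the $\sigma$-algebra generated by $\{I_n(x):x\in G\}$. For $n=\sum_{k\ge 0} n_k2^k$ with $n_k\in\{0,1\}$ let $w_n(x)=\prod_{k\ge 0}\big((-1)^{x_k}\big)^{n_k}$ be the $n$-th Walsh function. For a real- or complex-valued martingale $F=(F_n)_{n\in\mathbb N}$ with respect to $(\zeta_n)_{n\in\mathbb N}$ put $$\widehat F(k)=\lim_{n\to\infty}\int_G F_n w_k\,d\mu,\qquad S_nF=\sum_{k=0}^{n-1}\widehat F(k)w_k,\qquad \sigma_nF=\frac1n\sum_{k=1}^{n}S_kF\quad(n\ge 1).$$ With $\|f\|_{1/2}=\left(\int_G|f|^{1/2}d\mu\right)^{2}$, the martingale Hardy space $H_{1/2}(G)$ consists of all such martingales with $\|F\|_{H_{1/2}}:=\big\|\sup_{n\in\mathbb N}|F_n|\big\|_{1/2}<\infty$.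 For $s\in\mathbb N$ and $0\le k\le s-1$ let $\alpha_k^s=2^s+2^0+2^1+\dots+2^k$, and define the restricted weighted maximal operator $$\widetilde\sigma_4^{*,\nabla}F:=\sup_{s\in\mathbb N}\ \sup_{0\le k\le s-1}\frac{|\sigma_{\alpha_k^s}F|}{\log^2\alpha_k^s}.$$ Then $\widetilde\sigma_4^{*,\nabla}$ is bounded from $H_{1/2}(G)$ to $L_{1/2}(G)$: there is a constant $c<\infty$ such that for every $F\in H_{1/2}(G)$ the function $\widetilde\sigma_4^{*,\nabla}F$ belongs to $L_{1/2}(G)$ and $$\big\|\widetilde\sigma_4^{*,\nabla}F\big\|_{1/2}\le c\,\|F\|_{H_{1/2}}.$$ -/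

import Mathlib

open MeasureTheory ProbabilityTheory Filter
open scoped ENNReal NNReal Topology

noncomputable section

namespace WalshFejer

/-- The dyadic group: the countable product of copies of the cyclic group of order two.
A point is a sequence `x = (x 0, x 1, …)`. -/
abbrev DyadicGroup : Type := ℕ → ZMod 2

/-- The normalized Haar measure on the dyadic group: the product of the measures on the factors
that give mass `1/2` to each point. -/
def haarG : Measure DyadicGroup :=
  Measure.infinitePi fun _ : ℕ => (PMF.uniformOfFintype (ZMod 2)).toMeasure

instance instIsProbabilityMeasureHaarG : IsProbabilityMeasure haarG := by
  unfold haarG; infer_instance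

/-- The dyadic interval `I_n(x)` of rank `n` around `x`. -/
def dyadicInterval (n : ℕ) (x : DyadicGroup) : Set DyadicGroup :=
  {y | ∀ i < n, y i = x i}

theorem finite_range_dyadicInterval (n : ℕ) : (Set.range (dyadicInterval n)).Finite := by
  have h : Set.range (dyadicInterval n) ⊆ Set.range
      (fun v : Fin n → ZMod 2 => {y : DyadicGroup | ∀ i : Fin n, y i = v i}) := by
    rintro _ ⟨x, rfl⟩
    refine ⟨fun i => x i, ?_⟩
    ext y
    exact ⟨fun hy i hi => hy ⟨i, hi⟩, fun hy i => hy i i.2⟩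
  exact (Set.finite_range _).subset h

theorem measurableSet_dyadicInterval (n : ℕ) (x : DyadicGroup) :
    MeasurableSet (dyadicInterval n x) := by
  have h : dyadicInterval n x = ⋂ i ∈ Set.Iio n, (fun y : DyadicGroup => y i) ⁻¹' {x i} := by
    ext y; simp [dyadicInterval]
  rw [h]
  exact MeasurableSet.biInter (Set.to_countable _)
    fun i _ => measurable_pi_apply i (MeasurableSet.singleton _)

/-- The filtration of the dyadic group whose `n`-th sigma-algebra is generated by the dyadic
intervals of rank `n`. -/
def dyadicFiltration :
    Filtration ℕ (MeasurableSpace.pi : MeasurableSpace DyadicGroup) where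
  seq n := MeasurableSpace.generateFrom (Set.range (dyadicInterval n))
  mono' := by
    intro n m hnm
    refine MeasurableSpace.generateFrom_le ?_
    rintro _ ⟨x, rfl⟩
    have h : dyadicInterval n x = ⋃₀ (dyadicInterval m '' dyadicInterval n x) := by
      ext y
      constructor
      · intro hy
        exact ⟨_, ⟨y, hy, rfl⟩, fun i _ => rfl⟩
      · rintro ⟨_, ⟨z, hz, rfl⟩, hy⟩ i hi
        rw [hy i (lt_of_lt_of_le hi hnm), hz i hi]
    rw [h]
    refine MeasurableSet.sUnion
      (((finite_range_dyadicInterval m).subset (Set.image_subset_range _ _)).countable) ?_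
    rintro _ ⟨z, _, rfl⟩
    exact MeasurableSpace.measurableSet_generateFrom ⟨z, rfl⟩
  le' := by
    intro n
    refine MeasurableSpace.generateFrom_le ?_
    rintro _ ⟨x, rfl⟩
    exact measurableSet_dyadicInterval n x

/-- The Rademacher functions `r_k(x) = (-1)^(x_k)`. -/
def rademacher (k : ℕ) (x : DyadicGroup) : ℝ := (-1) ^ (x k).val

/-- The Walsh functions `w_n = ∏ r_k^(n_k)`, where the `n_k` are the binary digits of `n`
(which vanish for `k` at least the number `n.size` of binary digits). -/
def walsh (n : ℕ) (x : DyadicGroup) : ℝ :=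
  ∏ k ∈ Finset.range n.size, rademacher k x ^ (n.testBit k).toNat

variable {𝕜 : Type*} [RCLike 𝕜]

/-- The Walsh–Fourier coefficients of a martingale: the limit of `∫ F_n w_k` as `n → ∞`. -/
def walshCoeff (F : ℕ → DyadicGroup → 𝕜) (k : ℕ) : 𝕜 :=
  limUnder atTop fun n : ℕ => ∫ x, walsh k x • F n x ∂haarG

/-- The `n`-th partial sum `S_n F` of the Walsh–Fourier series. -/
def partialSum (F : ℕ → DyadicGroup → 𝕜) (n : ℕ) (x : DyadicGroup) : 𝕜 :=
  ∑ k ∈ Finset.range n, walsh k x • walshCoeff F k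

/-- The `n`-th Fejér mean `σ_n F = (1/n) ∑_{k=1}^n S_k F`. -/
def fejerMean (F : ℕ → DyadicGroup → 𝕜) (n : ℕ) (x : DyadicGroup) : 𝕜 :=
  (n : 𝕜)⁻¹ * ∑ k ∈ Finset.Icc 1 n, partialSum F k x

/-- The martingale Hardy (quasi-)norm: the `L_p` (quasi-)norm of `sup_n |F_n|`. -/
def hardyNorm (p : ℝ≥0∞) (F : ℕ → DyadicGroup → 𝕜) : ℝ≥0∞ :=
  eLpNorm (fun x => ⨆ n : ℕ, ‖F n x‖ₑ) p haarG

/-- Membership in the martingale Hardy space `H_p`. -/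
def MemHardy (p : ℝ≥0∞) (F : ℕ → DyadicGroup → 𝕜) : Prop :=
  Martingale F dyadicFiltration haarG ∧ hardyNorm p F < ∞

/-- The numbers `α_k^s = 2^s + 2^0 + 2^1 + … + 2^k`. -/
def alpha (s k : ℕ) : ℕ := 2 ^ s + ∑ i ∈ Finset.range (k + 1), 2 ^ i

/-- The weighted restricted maximal operator
`F ↦ sup_s sup_{0 ≤ k ≤ s - 1} |σ_{α_k^s} F| / log² α_k^s`, with values in `[0, ∞]`. -/
def weightedMaximal (F : ℕ → DyadicGroup → 𝕜) (x : DyadicGroup) : ℝ≥0∞ :=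
  ⨆ s : ℕ, ⨆ k : ℕ, ⨆ _ : k < s,
    ENNReal.ofReal (‖fejerMean F (alpha s k) x‖ / Real.log (alpha s k) ^ 2)

end WalshFejer

end

/-!
Let `n < 2 ^ (s + 1)`. The Fejér kernel `n K_n` is dominated by twice the sum over the levels
`i ≤ s` of the positive kernels `∑_{j ≤ i} 2 ^ j D_{2^i}(· + e_j)`. As `F_{s+1}` is
`ζ_{s+1}`-measurable, a reverse Hölder inequality bounds averages of `|F_{s+1}|` by squares of
averages of `|F_{s+1}|^{1/2}`, so that `|σ_n F|^{1/2} ≤ 2 ∑_{i ≤ s} Q_i(|F_{s+1}|^{1/2})` with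
positive operators `Q_i` that are uniformly bounded on `L_1`.

The running maximum of `|F_n|^{1/2}` is the sum of its increments `δ_m ≥ 0`, and `δ_m` is
`ζ_m`-measurable. The Cesàro means `s⁻¹ ∑_{i ≤ s} Q_i δ_m`, `s ≥ m - 1`, have a common bound whose
`L_1`-norm is at most a multiple of that of `δ_m`, because the levels `i > m` are controlled by
the level `m`. The weight `log² n ~ s²` supplies exactly the factor `s⁻¹` after taking square roots.
-/

namespace WalshFejer

/-! ### Dyadic intervals and translations -/

/-- The translation `x ↦ x + e_j` by the `j`-th generator of the dyadic group. -/
def shift (j : ℕ) (x : DyadicGroup) : DyadicGroup := x + Pi.single j 1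

theorem shift_apply_self (j : ℕ) (x : DyadicGroup) : shift j x j = x j + 1 := by
  simp [shift]

theorem shift_apply_of_ne {i j : ℕ} (h : i ≠ j) (x : DyadicGroup) : shift j x i = x i := by
  simp [shift, h]

theorem shift_mem_dyadicInterval {n j : ℕ} (h : n ≤ j) (x : DyadicGroup) :
    shift j x ∈ dyadicInterval n x :=
  fun _ hi => shift_apply_of_ne (hi.trans_le h).ne x

theorem mem_dyadicInterval_self (n : ℕ) (x : DyadicGroup) : x ∈ dyadicInterval n x :=
  fun _ _ => rfl

theorem mem_dyadicInterval_comm {n : ℕ} {x y : DyadicGroup} :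
    y ∈ dyadicInterval n x ↔ x ∈ dyadicInterval n y :=
  forall₂_congr fun _ _ => eq_comm

theorem dyadicInterval_anti {m n : ℕ} (h : m ≤ n) (x : DyadicGroup) :
    dyadicInterval n x ⊆ dyadicInterval m x :=
  fun _ hy i hi => hy i (hi.trans_le h)

theorem dyadicInterval_eq_of_mem {n : ℕ} {x y : DyadicGroup} (h : y ∈ dyadicInterval n x) :
    dyadicInterval n y = dyadicInterval n x :=
  Set.ext fun _ => forall₂_congr fun i hi => by rw [h i hi]

theorem mem_dyadicInterval_succ {n : ℕ} {x y : DyadicGroup} :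
    y ∈ dyadicInterval (n + 1) x ↔ y ∈ dyadicInterval n x ∧ y n = x n :=
  Nat.forall_lt_succ_right

/-- The indicator function of `I_n(x)` as a kernel in the two variables `x` and `y`; it is
`2 ^ (-n)` times the Dirichlet kernel `D_{2^n}(x - y)`. -/
noncomputable def intervalInd (n : ℕ) (x y : DyadicGroup) : ℝ :=
  (dyadicInterval n x).indicator 1 y

theorem intervalInd_nonneg (n : ℕ) (x y : DyadicGroup) : 0 ≤ intervalInd n x y :=
  Set.indicator_nonneg (fun _ _ => zero_le_one) _

theorem intervalInd_zero (x y : DyadicGroup) : intervalInd 0 x y = 1 := by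
  simp [intervalInd, dyadicInterval]

theorem intervalInd_shift_of_le {n j : ℕ} (h : n ≤ j) (x y : DyadicGroup) :
    intervalInd n (shift j x) y = intervalInd n x y := by
  rw [intervalInd, dyadicInterval_eq_of_mem (shift_mem_dyadicInterval h x), intervalInd]

/-! ### Walsh functions -/

theorem eq_zero_or_eq_one_of_zmod_two : ∀ a : ZMod 2, a = 0 ∨ a = 1 := by decide

theorem abs_rademacher (k : ℕ) (x : DyadicGroup) : |rademacher k x| = 1 :=
  abs_neg_one_pow _

theorem rademacher_eq_ite (k : ℕ) (x : DyadicGroup) :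
    rademacher k x = if x k = 0 then 1 else -1 := by
  rcases eq_zero_or_eq_one_of_zmod_two (x k) with h | h <;> simp [rademacher, h, ZMod.val_one]

theorem rademacher_mul_rademacher (k : ℕ) (x y : DyadicGroup) :
    rademacher k x * rademacher k y = if y k = x k then 1 else -1 := by
  rw [rademacher_eq_ite, rademacher_eq_ite]
  rcases eq_zero_or_eq_one_of_zmod_two (x k) with hx | hx <;>
    rcases eq_zero_or_eq_one_of_zmod_two (y k) with hy | hy <;> simp [hx, hy]

theorem rademacher_shift_self (k : ℕ) (x : DyadicGroup) :
    rademacher k (shift k x) = -rademacher k x := by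
  rw [rademacher_eq_ite, rademacher_eq_ite, shift_apply_self]
  rcases eq_zero_or_eq_one_of_zmod_two (x k) with h | h <;> simp [h, CharTwo.add_self_eq_zero]

theorem rademacher_shift_of_ne {j k : ℕ} (h : k ≠ j) (x : DyadicGroup) :
    rademacher k (shift j x) = rademacher k x := by
  rw [rademacher, rademacher, shift_apply_of_ne h]

theorem measurable_rademacher (k : ℕ) : Measurable (rademacher k) :=
  (measurable_of_countable fun a : ZMod 2 => (-1 : ℝ) ^ a.val).comp (measurable_pi_apply k)

theorem two_mul_intervalInd_succ (n : ℕ) (x y : DyadicGroup) :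
    2 * intervalInd (n + 1) x y = (1 + rademacher n x * rademacher n y) * intervalInd n x y := by
  classical
  simp only [rademacher_mul_rademacher, intervalInd, Set.indicator_apply, mem_dyadicInterval_succ,
    Pi.one_apply]
  by_cases h : y n = x n <;> norm_num [h]

theorem walsh_zero (x : DyadicGroup) : walsh 0 x = 1 := by simp [walsh]

theorem walsh_eq_prod_range {n N : ℕ} (h : n < 2 ^ N) (x : DyadicGroup) :
    walsh n x = ∏ k ∈ Finset.range N, rademacher k x ^ (n.testBit k).toNat := by
  refine Finset.prod_subset (Finset.range_mono (Nat.size_le.2 h)) fun k _ hk => ?_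
  rw [Nat.testBit_eq_false_of_lt (Nat.size_le.1 (by simpa using hk)), Bool.toNat_false, pow_zero]

theorem walsh_two_pow_add {s j : ℕ} (h : j < 2 ^ s) (x : DyadicGroup) :
    walsh (2 ^ s + j) x = rademacher s x * walsh j x := by
  have hlow : ∀ k ∈ Finset.range s, (2 ^ s + j).testBit k = j.testBit k := fun k hk =>
    Nat.testBit_two_pow_add_gt (Finset.mem_range.1 hk) j
  have htop : (2 ^ s + j).testBit s = true := by
    rw [Nat.testBit_two_pow_add_eq, Nat.testBit_eq_false_of_lt h, Bool.not_false]
  rw [walsh_eq_prod_range (N := s + 1) (by rw [pow_succ]; lia), Finset.prod_range_succ, htop,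
    Bool.toNat_true, pow_one, mul_comm, walsh_eq_prod_range h,
    Finset.prod_congr rfl fun k hk => by rw [hlow k hk]]

theorem abs_walsh (n : ℕ) (x : DyadicGroup) : |walsh n x| = 1 := by
  simp [walsh, Finset.abs_prod, abs_pow, abs_rademacher]

theorem measurable_walsh (n : ℕ) : Measurable (walsh n) :=
  Finset.measurable_fun_prod _ fun k _ => (measurable_rademacher k).pow_const _

/-! ### Dirichlet and Fejér kernels -/

/-- The Dirichlet kernel `D_n(x - y)`. Walsh functions are characters of order two, so that
`w_i(x - y) = w_i(x) w_i(y)`. -/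
noncomputable def dirichletKernel (n : ℕ) (x y : DyadicGroup) : ℝ :=
  ∑ i ∈ Finset.range n, walsh i x * walsh i y

/-- The unnormalized Fejér kernel `n K_n(x - y) = D_1(x - y) + … + D_n(x - y)`. -/
noncomputable def fejerSum (n : ℕ) (x y : DyadicGroup) : ℝ :=
  ∑ j ∈ Finset.Icc 1 n, dirichletKernel j x y

theorem dirichletKernel_two_pow_add {s j : ℕ} (h : j ≤ 2 ^ s) (x y : DyadicGroup) :
    dirichletKernel (2 ^ s + j) x y =
      dirichletKernel (2 ^ s) x y + rademacher s x * rademacher s y * dirichletKernel j x y := by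
  unfold dirichletKernel
  rw [Finset.sum_range_add, Finset.mul_sum]
  congr 1
  refine Finset.sum_congr rfl fun i hi => ?_
  have hi : i < 2 ^ s := (Finset.mem_range.1 hi).trans_le h
  rw [walsh_two_pow_add hi, walsh_two_pow_add hi]
  ring

theorem dirichletKernel_two_pow (k : ℕ) (x y : DyadicGroup) :
    dirichletKernel (2 ^ k) x y = 2 ^ k * intervalInd k x y := by
  induction k with
  | zero => simp [dirichletKernel, walsh_zero, intervalInd_zero]
  | succ k ih =>
    rw [pow_succ, mul_two, dirichletKernel_two_pow_add le_rfl, ih]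
    linear_combination -2 ^ k * two_mul_intervalInd_succ k x y

theorem fejerSum_succ (n : ℕ) (x y : DyadicGroup) :
    fejerSum (n + 1) x y = fejerSum n x y + dirichletKernel (n + 1) x y :=
  Finset.sum_Icc_succ_top (Nat.le_add_left 1 n) _

theorem fejerSum_two_pow_add {s m : ℕ} (h : m ≤ 2 ^ s) (x y : DyadicGroup) :
    fejerSum (2 ^ s + m) x y = fejerSum (2 ^ s) x y + m * (2 ^ s * intervalInd s x y)
      + rademacher s x * rademacher s y * fejerSum m x y := by
  induction m with
  | zero => simp [fejerSum]
  | succ m ih =>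
    rw [← add_assoc, fejerSum_succ, ih (by lia), add_assoc (2 ^ s), dirichletKernel_two_pow_add h,
      dirichletKernel_two_pow, fejerSum_succ]
    push_cast
    ring

/-- The positive kernel `∑_{j ≤ k} 2 ^ j D_{2^k}(x + e_j - y)`, which dominates the Fejér kernel
of order `2 ^ k`. -/
noncomputable def shiftKernel (k : ℕ) (x y : DyadicGroup) : ℝ :=
  ∑ j ∈ Finset.range (k + 1), 2 ^ j * (2 ^ k * intervalInd k (shift j x) y)

theorem shiftKernel_nonneg (k : ℕ) (x y : DyadicGroup) : 0 ≤ shiftKernel k x y :=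
  Finset.sum_nonneg fun _ _ =>
    mul_nonneg (by positivity) (mul_nonneg (by positivity) (intervalInd_nonneg _ _ _))

theorem measurable_shiftKernel (k : ℕ) (x : DyadicGroup) : Measurable (shiftKernel k x) :=
  Finset.measurable_fun_sum _ fun _ _ =>
    ((measurable_one.indicator (measurableSet_dyadicInterval _ _)).const_mul _).const_mul _

theorem two_pow_mul_intervalInd_le_shiftKernel (k : ℕ) (x y : DyadicGroup) :
    2 ^ k * (2 ^ k * intervalInd k x y) ≤ shiftKernel k x y := by
  rw [← intervalInd_shift_of_le (le_refl k) x y]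
  exact Finset.single_le_sum
    (f := fun j => (2 : ℝ) ^ j * (2 ^ k * intervalInd k (shift j x) y))
    (fun _ _ => mul_nonneg (by positivity) (mul_nonneg (by positivity) (intervalInd_nonneg _ _ _)))
    (Finset.self_mem_range_succ k)

theorem shiftKernel_succ (k : ℕ) (x y : DyadicGroup) :
    shiftKernel (k + 1) x y = (1 + rademacher k x * rademacher k y) * shiftKernel k x y
      + 2 * (2 ^ k * (2 ^ k * intervalInd k x y)) := by
  have hlow : ∀ j ∈ Finset.range k,
      (2 : ℝ) ^ j * (2 ^ (k + 1) * intervalInd (k + 1) (shift j x) y) =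
        (1 + rademacher k x * rademacher k y) *
          (2 ^ j * (2 ^ k * intervalInd k (shift j x) y)) := by
    intro j hj
    have h := two_mul_intervalInd_succ k (shift j x) y
    rw [rademacher_shift_of_ne (Finset.mem_range.1 hj).ne'] at h
    linear_combination 2 ^ j * 2 ^ k * h
  have hself := two_mul_intervalInd_succ k x y
  have hshift := two_mul_intervalInd_succ k (shift k x) y
  rw [rademacher_shift_self, intervalInd_shift_of_le le_rfl] at hshift
  rw [shiftKernel, Finset.sum_range_succ, Finset.sum_range_succ, Finset.sum_congr rfl hlow,
    intervalInd_shift_of_le le_rfl, shiftKernel, Finset.sum_range_succ,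
    intervalInd_shift_of_le le_rfl, ← Finset.mul_sum]
  linear_combination 2 ^ k * 2 ^ k * (2 * hself + hshift)

theorem two_mul_fejerSum_two_pow (k : ℕ) (x y : DyadicGroup) :
    2 * fejerSum (2 ^ k) x y = shiftKernel k x y + 2 ^ k * intervalInd k x y := by
  induction k with
  | zero => norm_num [fejerSum, dirichletKernel, walsh_zero, shiftKernel, intervalInd_zero]
  | succ k ih =>
    have hI := two_mul_intervalInd_succ k x y
    rw [pow_succ, mul_two, fejerSum_two_pow_add le_rfl, shiftKernel_succ]
    push_cast
    linear_combination (1 + rademacher k x * rademacher k y) * ih - 2 ^ k * hI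

theorem abs_fejerSum_two_pow_add_le {s m : ℕ} (h : m ≤ 2 ^ s) (x y : DyadicGroup) :
    |fejerSum (2 ^ s + m) x y| ≤ 2 * shiftKernel s x y + |fejerSum m x y| := by
  have hI : 0 ≤ 2 ^ s * intervalInd s x y := mul_nonneg (by positivity) (intervalInd_nonneg _ _ _)
  have hm : (m : ℝ) ≤ 2 ^ s := mod_cast h
  have hK := two_pow_mul_intervalInd_le_shiftKernel s x y
  have hD : m * (2 ^ s * intervalInd s x y) ≤ shiftKernel s x y := by
    refine le_trans ?_ hK
    gcongr
  have hD0 : 0 ≤ m * (2 ^ s * intervalInd s x y) := by positivity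
  have hF := two_mul_fejerSum_two_pow s x y
  have hIK : 2 ^ s * intervalInd s x y ≤ shiftKernel s x y :=
    (le_mul_of_one_le_left hI (one_le_pow₀ one_le_two)).trans hK
  have hr : |rademacher s x * rademacher s y * fejerSum m x y| = |fejerSum m x y| := by
    rw [abs_mul, abs_mul, abs_rademacher, abs_rademacher, one_mul, one_mul]
  rw [fejerSum_two_pow_add h]
  refine (abs_add_le _ _).trans ?_
  rw [hr, abs_of_nonneg (by linarith [shiftKernel_nonneg s x y])]
  linarith

theorem abs_fejerSum_le {n N : ℕ} (h : n < 2 ^ N) (x y : DyadicGroup) :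
    |fejerSum n x y| ≤ 2 * ∑ i ∈ Finset.range N, shiftKernel i x y := by
  induction N generalizing n with
  | zero => simp [fejerSum, Nat.lt_one_iff.1 h]
  | succ N ih =>
    rw [Finset.sum_range_succ, mul_add]
    rcases lt_or_ge n (2 ^ N) with hn | hn
    · linarith [ih hn, shiftKernel_nonneg N x y]
    · obtain ⟨m, rfl⟩ := Nat.exists_eq_add_of_le hn
      have hm : m < 2 ^ N := by rw [pow_succ] at h; lia
      linarith [ih hm, abs_fejerSum_two_pow_add_le hm.le x y]

/-! ### Averages over dyadic intervals -/

theorem eq_of_mem_dyadicInterval {β : Type*} [MeasurableSpace β] [MeasurableSingletonClass β]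
    {n : ℕ} {f : DyadicGroup → β} (hf : Measurable[dyadicFiltration n] f) {x y : DyadicGroup}
    (h : y ∈ dyadicInterval n x) : f y = f x := by
  have mem_iff : ∀ S, MeasurableSet[dyadicFiltration n] S → (y ∈ S ↔ x ∈ S) := by
    intro S hS
    induction S, hS using MeasurableSpace.generateFrom_induction with
    | hC t ht _ =>
      obtain ⟨z, rfl⟩ := ht
      rw [mem_dyadicInterval_comm, dyadicInterval_eq_of_mem h, mem_dyadicInterval_comm]
    | empty => rfl
    | compl t _ ih => exact not_congr ih
    | iUnion s _ ih => simp only [Set.mem_iUnion, ih]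
  exact (mem_iff _ (hf (measurableSet_singleton (f x)))).2 rfl

theorem measurable_dyadicFiltration_of_eq {β : Type*} [MeasurableSpace β] {n : ℕ}
    {f : DyadicGroup → β} (hf : ∀ x, ∀ y ∈ dyadicInterval n x, f y = f x) :
    Measurable[dyadicFiltration n] f := by
  intro S _
  have h : f ⁻¹' S = ⋃₀ (dyadicInterval n '' (f ⁻¹' S)) := by
    refine Set.Subset.antisymm (fun y hy => ⟨_, ⟨y, hy, rfl⟩, mem_dyadicInterval_self n y⟩) ?_
    rintro y ⟨_, ⟨x, hx, rfl⟩, hy⟩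
    rwa [Set.mem_preimage, hf x y hy]
  rw [h]
  refine MeasurableSet.sUnion
    (((finite_range_dyadicInterval n).subset (Set.image_subset_range _ _)).countable) ?_
  rintro _ ⟨x, _, rfl⟩
  exact MeasurableSpace.measurableSet_generateFrom ⟨x, rfl⟩

theorem haarG_dyadicInterval (n : ℕ) (x : DyadicGroup) :
    haarG (dyadicInterval n x) = (2 ^ n)⁻¹ := by
  have h : dyadicInterval n x = Set.pi (Finset.range n) fun i => {x i} := by
    ext y; simp [dyadicInterval]
  rw [h, haarG, Measure.infinitePi_pi _ fun i _ => MeasurableSet.singleton _]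
  simp [ENNReal.inv_pow]

/-- The average of `f` over the dyadic interval `I_n(x)`, that is, the conditional expectation of
`f` given `ζ_n`, as an everywhere defined function. -/
noncomputable def dyadicAvg (n : ℕ) (f : DyadicGroup → ℝ≥0∞) (x : DyadicGroup) : ℝ≥0∞ :=
  ⨍⁻ y in dyadicInterval n x, f y ∂haarG

theorem dyadicAvg_eq_two_pow_mul (n : ℕ) (f : DyadicGroup → ℝ≥0∞) (x : DyadicGroup) :
    dyadicAvg n f x = 2 ^ n * ∫⁻ y in dyadicInterval n x, f y ∂haarG := by
  rw [dyadicAvg, setLAverage_eq, haarG_dyadicInterval, div_eq_mul_inv, inv_inv, mul_comm]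

theorem measurable_dyadicAvg (n : ℕ) (f : DyadicGroup → ℝ≥0∞) :
    Measurable[dyadicFiltration n] (dyadicAvg n f) :=
  measurable_dyadicFiltration_of_eq fun x y h => by
    rw [dyadicAvg, dyadicInterval_eq_of_mem h, dyadicAvg]

theorem dyadicAvg_mono (n : ℕ) {f g : DyadicGroup → ℝ≥0∞} (h : f ≤ g) (x : DyadicGroup) :
    dyadicAvg n f x ≤ dyadicAvg n g x :=
  lintegral_mono h

theorem dyadicAvg_finset_sum {ι : Type*} (n : ℕ) (t : Finset ι) {f : ι → DyadicGroup → ℝ≥0∞}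
    (hf : ∀ i, Measurable (f i)) (x : DyadicGroup) :
    dyadicAvg n (fun y => ∑ i ∈ t, f i y) x = ∑ i ∈ t, dyadicAvg n (f i) x :=
  lintegral_finsetSum _ fun i _ => hf i

theorem dyadicAvg_eq_self {m n : ℕ} (hmn : m ≤ n) {f : DyadicGroup → ℝ≥0∞}
    (hf : Measurable[dyadicFiltration m] f) (x : DyadicGroup) : dyadicAvg n f x = f x := by
  have h : ∀ y ∈ dyadicInterval n x, f y = f x := fun y hy =>
    eq_of_mem_dyadicInterval hf (dyadicInterval_anti hmn x hy)
  rw [dyadicAvg, setLAverage_congr_fun (measurableSet_dyadicInterval n x) h,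
    setLAverage_const (by simp [haarG_dyadicInterval]) (by finiteness)]

theorem measurable_shift (j : ℕ) : Measurable (shift j) :=
  measurable_add_const _

theorem mem_dyadicInterval_shift_comm {n j : ℕ} {x y : DyadicGroup} :
    y ∈ dyadicInterval n (shift j x) ↔ x ∈ dyadicInterval n (shift j y) := by
  have key : ∀ a b c : ZMod 2, a = b + c ↔ b = a + c := by decide
  exact forall₂_congr fun _ _ => key _ _ _

theorem measurableSet_mem_dyadicInterval_shift (n j : ℕ) :
    MeasurableSet {p : DyadicGroup × DyadicGroup | p.2 ∈ dyadicInterval n (shift j p.1)} := by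
  have h : {p : DyadicGroup × DyadicGroup | p.2 ∈ dyadicInterval n (shift j p.1)} =
      ⋂ i ∈ Set.Iio n, {p | p.2 i = shift j p.1 i} := by
    ext p; simp [dyadicInterval]
  rw [h]
  exact MeasurableSet.biInter (Set.to_countable _) fun i _ => measurableSet_eq_fun (by fun_prop)
    ((measurable_pi_apply i).comp ((measurable_shift j).comp measurable_fst))

theorem lintegral_dyadicAvg_shift (n j : ℕ) {f : DyadicGroup → ℝ≥0∞} (hf : Measurable f) :
    ∫⁻ x, dyadicAvg n f (shift j x) ∂haarG = ∫⁻ x, f x ∂haarG := by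
  set A := {p : DyadicGroup × DyadicGroup | p.2 ∈ dyadicInterval n (shift j p.1)}
  have hA : Measurable (A.indicator fun p => 2 ^ n * f p.2) :=
    (by fun_prop : Measurable fun p : DyadicGroup × DyadicGroup => 2 ^ n * f p.2).indicator
      (measurableSet_mem_dyadicInterval_shift n j)
  have hsymm (x y : DyadicGroup) : A.indicator (fun p => 2 ^ n * f p.2) (x, y) =
      (dyadicInterval n (shift j y)).indicator (fun _ => 2 ^ n * f y) x := by
    classical
    rw [Set.indicator_apply, Set.indicator_apply]
    exact if_congr mem_dyadicInterval_shift_comm rfl rfl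
  calc ∫⁻ x, dyadicAvg n f (shift j x) ∂haarG
      = ∫⁻ x, ∫⁻ y, A.indicator (fun p => 2 ^ n * f p.2) (x, y) ∂haarG ∂haarG := by
        refine lintegral_congr fun x => ?_
        rw [dyadicAvg_eq_two_pow_mul, ← lintegral_const_mul _ hf,
          ← lintegral_indicator (measurableSet_dyadicInterval _ _)]
        rfl
    _ = ∫⁻ y, ∫⁻ x, A.indicator (fun p => 2 ^ n * f p.2) (x, y) ∂haarG ∂haarG :=
        lintegral_lintegral_swap hA.aemeasurable
    _ = ∫⁻ y, f y ∂haarG := by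
        refine lintegral_congr fun y => ?_
        simp only [hsymm]
        rw [lintegral_indicator_const (measurableSet_dyadicInterval _ _), haarG_dyadicInterval,
          mul_right_comm, ENNReal.mul_inv_cancel (by positivity) (by finiteness), one_mul]

/-- A reverse Hölder inequality: the values of a `ζ_n`-measurable function on an interval of rank
`k` are at most `2 ^ (n - k)` times its average there. -/
theorem dyadicAvg_sq_le {k n : ℕ} (hkn : k ≤ n) {g : DyadicGroup → ℝ≥0∞}
    (hg : Measurable[dyadicFiltration n] g) (x : DyadicGroup) :
    dyadicAvg k (fun y => g y ^ 2) x ≤ 2 ^ (n - k) * dyadicAvg k g x ^ 2 := by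
  have hsup : ∀ y ∈ dyadicInterval k x, g y ≤ 2 ^ (n - k) * dyadicAvg k g x := by
    intro y hy
    have hsub : dyadicInterval n y ⊆ dyadicInterval k x :=
      (dyadicInterval_anti hkn y).trans (dyadicInterval_eq_of_mem hy).subset
    rw [← dyadicAvg_eq_self le_rfl hg y, dyadicAvg_eq_two_pow_mul, dyadicAvg_eq_two_pow_mul,
      ← mul_assoc, ← pow_add, Nat.sub_add_cancel hkn]
    gcongr
  calc dyadicAvg k (fun y => g y ^ 2) x
      ≤ 2 ^ k * ∫⁻ y in dyadicInterval k x, (2 ^ (n - k) * dyadicAvg k g x) * g y ∂haarG := by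
        rw [dyadicAvg_eq_two_pow_mul]
        gcongr 2 ^ k * ?_
        refine setLIntegral_mono' (measurableSet_dyadicInterval k x) fun y hy => ?_
        rw [sq]
        gcongr
        exact hsup y hy
    _ = 2 ^ (n - k) * dyadicAvg k g x ^ 2 := by
        rw [lintegral_const_mul _ (hg.mono (dyadicFiltration.le n) le_rfl), mul_left_comm,
          ← dyadicAvg_eq_two_pow_mul, mul_assoc, sq]

/-! ### Averages over translated intervals -/

/-- The ratio `2^{-1/2}` of the weights of consecutive translations in `shiftAvg`. -/
noncomputable def invSqrtTwo : ℝ≥0∞ := 2⁻¹ ^ (1 / 2 : ℝ)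

theorem invSqrtTwo_sq : invSqrtTwo ^ 2 = 2⁻¹ := by
  rw [invSqrtTwo, ← ENNReal.rpow_natCast, ← ENNReal.rpow_mul]; norm_num

theorem invSqrtTwo_lt_one : invSqrtTwo < 1 :=
  ENNReal.rpow_lt_one (by norm_num) (by norm_num)

/-- The sum of the geometric series of ratio `2^{-1/2}`. -/
noncomputable def geomConst : ℝ≥0∞ := ∑' n : ℕ, invSqrtTwo ^ n

theorem geomConst_ne_top : geomConst ≠ ∞ := by
  rw [geomConst, ENNReal.tsum_geometric]
  exact ENNReal.inv_ne_top.2 (tsub_pos_of_lt invSqrtTwo_lt_one).ne'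

theorem sum_invSqrtTwo_pow_le (k : ℕ) :
    ∑ j ∈ Finset.range (k + 1), invSqrtTwo ^ (k - j) ≤ geomConst := by
  rw [← Finset.sum_range_reflect]
  refine (Finset.sum_le_sum fun j hj => ?_).trans (ENNReal.sum_le_tsum (Finset.range (k + 1)))
  have := Finset.mem_range.1 hj
  rw [show k - (k + 1 - 1 - j) = j by lia]

/-- The weighted sum `∑_{j ≤ k} 2^{-(k-j)/2} E(f | ζ_k)(x + e_j)` of averages over translated
intervals: the operator that `shiftKernel k` turns into when square roots are taken. -/
noncomputable def shiftAvg (k : ℕ) (f : DyadicGroup → ℝ≥0∞) (x : DyadicGroup) : ℝ≥0∞ :=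
  ∑ j ∈ Finset.range (k + 1), invSqrtTwo ^ (k - j) * dyadicAvg k f (shift j x)

theorem shiftAvg_mono (k : ℕ) {f g : DyadicGroup → ℝ≥0∞} (h : f ≤ g) (x : DyadicGroup) :
    shiftAvg k f x ≤ shiftAvg k g x := by
  unfold shiftAvg
  gcongr
  exact dyadicAvg_mono _ h _

theorem shiftAvg_finset_sum {ι : Type*} (k : ℕ) (t : Finset ι) {f : ι → DyadicGroup → ℝ≥0∞}
    (hf : ∀ i, Measurable (f i)) (x : DyadicGroup) :
    shiftAvg k (fun y => ∑ i ∈ t, f i y) x = ∑ i ∈ t, shiftAvg k (f i) x := by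
  simp only [shiftAvg, dyadicAvg_finset_sum k t hf, Finset.mul_sum]
  exact Finset.sum_comm

theorem measurable_dyadicAvg_shift (k j : ℕ) (f : DyadicGroup → ℝ≥0∞) :
    Measurable fun x => dyadicAvg k f (shift j x) :=
  ((measurable_dyadicAvg k f).mono (dyadicFiltration.le k) le_rfl).comp (measurable_shift j)

theorem measurable_shiftAvg (k : ℕ) (f : DyadicGroup → ℝ≥0∞) : Measurable (shiftAvg k f) :=
  Finset.measurable_fun_sum _ fun j _ => (measurable_dyadicAvg_shift k j f).const_mul _

theorem lintegral_shiftAvg_le (k : ℕ) {f : DyadicGroup → ℝ≥0∞} (hf : Measurable f) :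
    ∫⁻ x, shiftAvg k f x ∂haarG ≤ geomConst * ∫⁻ x, f x ∂haarG := by
  unfold shiftAvg
  rw [lintegral_finsetSum _ fun j _ => (measurable_dyadicAvg_shift k j f).const_mul _]
  simp only [lintegral_const_mul _ (measurable_dyadicAvg_shift k _ f),
    lintegral_dyadicAvg_shift k _ hf, ← Finset.sum_mul]
  gcongr
  exact sum_invSqrtTwo_pow_le k

theorem shiftAvg_eq_of_measurable {k m : ℕ} (hmk : m ≤ k) {f : DyadicGroup → ℝ≥0∞}
    (hf : Measurable[dyadicFiltration m] f) (x : DyadicGroup) :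
    shiftAvg k f x = ∑ j ∈ Finset.range (k + 1), invSqrtTwo ^ (k - j) * f (shift j x) :=
  Finset.sum_congr rfl fun j _ => by rw [dyadicAvg_eq_self hmk hf]

theorem self_le_shiftAvg {m : ℕ} {f : DyadicGroup → ℝ≥0∞}
    (hf : Measurable[dyadicFiltration m] f) (x : DyadicGroup) : f x ≤ shiftAvg m f x := by
  have hm : f (shift m x) = f x := eq_of_mem_dyadicInterval hf (shift_mem_dyadicInterval le_rfl x)
  rw [shiftAvg_eq_of_measurable le_rfl hf, Finset.sum_range_succ, hm, Nat.sub_self, pow_zero,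
    one_mul]
  exact le_add_self

/-- Translations by `e_j` with `j < m` already occur in `shiftAvg m`, with a larger weight; those
with `m ≤ j` leave `f` fixed and their weights are summable. -/
theorem shiftAvg_le_of_le {k m : ℕ} (hmk : m ≤ k) {f : DyadicGroup → ℝ≥0∞}
    (hf : Measurable[dyadicFiltration m] f) (x : DyadicGroup) :
    shiftAvg k f x ≤ (1 + geomConst) * shiftAvg m f x := by
  have hlow : ∑ j ∈ Finset.range m, invSqrtTwo ^ (k - j) * f (shift j x) ≤ shiftAvg m f x := by
    rw [shiftAvg_eq_of_measurable le_rfl hf, Finset.sum_range_succ]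
    refine le_add_right (Finset.sum_le_sum fun j _ => ?_)
    gcongr ?_ * _
    exact pow_le_pow_of_le_one zero_le invSqrtTwo_lt_one.le (by lia)
  have hhigh : ∑ j ∈ Finset.Ico m (k + 1), invSqrtTwo ^ (k - j) * f (shift j x)
      ≤ geomConst * shiftAvg m f x :=
    calc ∑ j ∈ Finset.Ico m (k + 1), invSqrtTwo ^ (k - j) * f (shift j x)
        = (∑ j ∈ Finset.Ico m (k + 1), invSqrtTwo ^ (k - j)) * f x := by
          rw [Finset.sum_mul]
          refine Finset.sum_congr rfl fun j hj => ?_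
          rw [eq_of_mem_dyadicInterval hf (shift_mem_dyadicInterval (Finset.mem_Ico.1 hj).1 x)]
      _ ≤ geomConst * shiftAvg m f x := by
          gcongr
          · refine (Finset.sum_le_sum_of_subset ?_).trans (sum_invSqrtTwo_pow_le k)
            rw [Finset.range_eq_Ico]
            exact Finset.Ico_subset_Ico_left m.zero_le
          · exact self_le_shiftAvg hf x
  rw [shiftAvg_eq_of_measurable hmk hf, ← Finset.sum_range_add_sum_Ico _ (by lia : m ≤ k + 1),
    add_mul, one_mul]
  exact add_le_add hlow hhigh

/-! ### Integrals against the kernels -/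

theorem lintegral_shiftKernel_mul (k : ℕ) (x : DyadicGroup) {h : DyadicGroup → ℝ≥0∞}
    (hh : Measurable h) :
    ∫⁻ y, ENNReal.ofReal (shiftKernel k x y) * h y ∂haarG =
      ∑ j ∈ Finset.range (k + 1), 2 ^ j * dyadicAvg k h (shift j x) := by
  have hsum (y : DyadicGroup) : ENNReal.ofReal (shiftKernel k x y) * h y =
      ∑ j ∈ Finset.range (k + 1),
        2 ^ j * (2 ^ k * (dyadicInterval k (shift j x)).indicator h y) := by
    rw [shiftKernel, ENNReal.ofReal_sum_of_nonneg fun j _ =>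
      mul_nonneg (by positivity) (mul_nonneg (by positivity) (intervalInd_nonneg _ _ _)),
      Finset.sum_mul]
    refine Finset.sum_congr rfl fun j _ => ?_
    by_cases hy : y ∈ dyadicInterval k (shift j x) <;>
      simp [intervalInd, hy, ENNReal.ofReal_mul, ENNReal.ofReal_pow, mul_assoc]
  have hind (j : ℕ) : Measurable ((dyadicInterval k (shift j x)).indicator h) :=
    hh.indicator (measurableSet_dyadicInterval _ _)
  simp only [hsum]
  rw [lintegral_finsetSum _ fun j _ => ((hind j).const_mul _).const_mul _]
  refine Finset.sum_congr rfl fun j _ => ?_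
  rw [lintegral_const_mul _ ((hind j).const_mul _), lintegral_const_mul _ (hind j),
    lintegral_indicator (measurableSet_dyadicInterval _ _), dyadicAvg_eq_two_pow_mul]

theorem lintegral_shiftKernel_mul_sq_le {k n : ℕ} (hkn : k ≤ n) {g : DyadicGroup → ℝ≥0∞}
    (hg : Measurable[dyadicFiltration n] g) (x : DyadicGroup) :
    ∫⁻ y, ENNReal.ofReal (shiftKernel k x y) * g y ^ 2 ∂haarG ≤ 2 ^ n * shiftAvg k g x ^ 2 := by
  have hweight : ∀ j ≤ k, (2 : ℝ≥0∞) ^ j * 2 ^ (n - k) = 2 ^ n * (invSqrtTwo ^ (k - j)) ^ 2 := by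
    intro j hj
    have hn : (2 : ℝ≥0∞) ^ n = 2 ^ j * 2 ^ (n - k) * 2 ^ (k - j) := by
      rw [← pow_add, ← pow_add]; congr 1; lia
    rw [← pow_mul, mul_comm (k - j), pow_mul, invSqrtTwo_sq, ← ENNReal.inv_pow, hn, mul_assoc,
      ENNReal.mul_inv_cancel (by positivity) (by finiteness), mul_one]
  have hgm : Measurable g := hg.mono (dyadicFiltration.le n) le_rfl
  rw [lintegral_shiftKernel_mul k x (hgm.pow_const 2)]
  calc ∑ j ∈ Finset.range (k + 1), 2 ^ j * dyadicAvg k (fun y => g y ^ 2) (shift j x)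
      ≤ ∑ j ∈ Finset.range (k + 1),
          2 ^ n * (invSqrtTwo ^ (k - j) * dyadicAvg k g (shift j x)) ^ 2 := by
        refine Finset.sum_le_sum fun j hj => ?_
        rw [mul_pow, ← mul_assoc, ← hweight j (Finset.mem_range_succ_iff.1 hj), mul_assoc]
        gcongr
        exact dyadicAvg_sq_le hkn hg _
    _ ≤ 2 ^ n * shiftAvg k g x ^ 2 := by
        rw [← Finset.mul_sum]
        gcongr
        exact Finset.sum_sq_le_sq_sum_of_nonneg fun _ _ => zero_le

theorem lintegral_enorm_fejerSum_mul_sq_le {n N : ℕ} (h : n < 2 ^ N) {g : DyadicGroup → ℝ≥0∞}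
    (hg : Measurable[dyadicFiltration N] g) (x : DyadicGroup) :
    ∫⁻ y, ‖fejerSum n x y‖ₑ * g y ^ 2 ∂haarG ≤
      2 * (2 ^ N * (∑ i ∈ Finset.range N, shiftAvg i g x) ^ 2) := by
  have hgm : Measurable g := hg.mono (dyadicFiltration.le N) le_rfl
  have hmeas (i : ℕ) : Measurable fun y => ENNReal.ofReal (shiftKernel i x y) * g y ^ 2 :=
    (measurable_shiftKernel i x).ennreal_ofReal.mul (hgm.pow_const 2)
  have hker (y : DyadicGroup) : ‖fejerSum n x y‖ₑ * g y ^ 2 ≤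
      2 * ∑ i ∈ Finset.range N, ENNReal.ofReal (shiftKernel i x y) * g y ^ 2 := by
    rw [← Finset.sum_mul, ← mul_assoc, Real.enorm_eq_ofReal_abs,
      ← ENNReal.ofReal_sum_of_nonneg fun i _ => shiftKernel_nonneg i x y, ← ENNReal.ofReal_ofNat 2,
      ← ENNReal.ofReal_mul zero_le_two]
    gcongr
    exact abs_fejerSum_le h x y
  calc ∫⁻ y, ‖fejerSum n x y‖ₑ * g y ^ 2 ∂haarG
      ≤ 2 * ∑ i ∈ Finset.range N, ∫⁻ y, ENNReal.ofReal (shiftKernel i x y) * g y ^ 2 ∂haarG := by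
        rw [← lintegral_finsetSum _ fun i _ => hmeas i,
          ← lintegral_const_mul _ (Finset.measurable_fun_sum _ fun i _ => hmeas i)]
        exact lintegral_mono hker
    _ ≤ 2 * ∑ i ∈ Finset.range N, 2 ^ N * shiftAvg i g x ^ 2 := by
        gcongr with i hi
        exact lintegral_shiftKernel_mul_sq_le (Finset.mem_range.1 hi).le hg x
    _ ≤ 2 * (2 ^ N * (∑ i ∈ Finset.range N, shiftAvg i g x) ^ 2) := by
        rw [← Finset.mul_sum]
        gcongr
        exact Finset.sum_sq_le_sq_sum_of_nonneg fun _ _ => zero_le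

/-! ### Fejér means of martingales -/

theorem measurable_dyadicFiltration_walsh {k N : ℕ} (h : k < 2 ^ N) :
    Measurable[dyadicFiltration N] (walsh k) := by
  refine measurable_dyadicFiltration_of_eq fun x y hy => ?_
  rw [walsh_eq_prod_range h, walsh_eq_prod_range h]
  refine Finset.prod_congr rfl fun i hi => ?_
  rw [rademacher, rademacher, hy i (Finset.mem_range.1 hi)]

theorem integrable_walsh_smul {E : Type*} [NormedAddCommGroup E] [NormedSpace ℝ E] (k : ℕ)
    {f : DyadicGroup → E} (hf : Integrable f haarG) :
    Integrable (fun x => walsh k x • f x) haarG :=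
  hf.bdd_smul 1 (measurable_walsh k).aestronglyMeasurable <|
    ae_of_all _ fun x => (abs_walsh k x).le

theorem integrable_dirichletKernel_smul {E : Type*} [NormedAddCommGroup E] [NormedSpace ℝ E]
    (n : ℕ) (x : DyadicGroup) {f : DyadicGroup → E} (hf : Integrable f haarG) :
    Integrable (fun y => dirichletKernel n x y • f y) haarG := by
  simp only [dirichletKernel, Finset.sum_smul, mul_smul]
  exact integrable_finsetSum _ fun i _ => (integrable_walsh_smul i hf).fun_smul _

theorem integral_walsh_smul_eq {E : Type*} [NormedAddCommGroup E] [NormedSpace ℝ E]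
    [CompleteSpace E] {F : ℕ → DyadicGroup → E} (hF : Martingale F dyadicFiltration haarG)
    {k N n : ℕ} (hk : k < 2 ^ N) (hn : N ≤ n) :
    ∫ x, walsh k x • F n x ∂haarG = ∫ x, walsh k x • F N x ∂haarG := by
  rw [← integral_condExp (dyadicFiltration.le N)]
  have hpull : haarG[fun x => walsh k x • F n x | dyadicFiltration N] =ᵐ[haarG]
      walsh k • haarG[F n | dyadicFiltration N] :=
    condExp_smul_of_aestronglyMeasurable_left
      (measurable_dyadicFiltration_walsh hk).stronglyMeasurable.aestronglyMeasurable
      (integrable_walsh_smul k (hF.integrable n)) (hF.integrable n)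
  refine integral_congr_ae (hpull.trans ?_)
  filter_upwards [hF.condExp_ae_eq hn] with x hx
  rw [Pi.smul_apply', hx]

variable {𝕜 : Type*} [RCLike 𝕜]

theorem walshCoeff_eq_integral {F : ℕ → DyadicGroup → 𝕜}
    (hF : Martingale F dyadicFiltration haarG) {k N : ℕ} (hk : k < 2 ^ N) :
    walshCoeff F k = ∫ x, walsh k x • F N x ∂haarG :=
  (tendsto_atTop_of_eventually_const fun _ hn => integral_walsh_smul_eq hF hk hn).limUnder_eq

theorem partialSum_eq_integral {F : ℕ → DyadicGroup → 𝕜}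
    (hF : Martingale F dyadicFiltration haarG) {n N : ℕ} (hn : n ≤ 2 ^ N) (x : DyadicGroup) :
    partialSum F n x = ∫ y, dirichletKernel n x y • F N y ∂haarG := by
  simp only [dirichletKernel, Finset.sum_smul, mul_smul]
  rw [integral_finsetSum _ fun i _ => (integrable_walsh_smul i (hF.integrable N)).fun_smul _]
  refine Finset.sum_congr rfl fun i hi => ?_
  rw [integral_smul, walshCoeff_eq_integral hF ((Finset.mem_range.1 hi).trans_le hn)]

theorem fejerMean_eq_integral {F : ℕ → DyadicGroup → 𝕜}
    (hF : Martingale F dyadicFiltration haarG) {n N : ℕ} (hn : n ≤ 2 ^ N) (x : DyadicGroup) :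
    fejerMean F n x = (n : 𝕜)⁻¹ * ∫ y, fejerSum n x y • F N y ∂haarG := by
  simp only [fejerSum, Finset.sum_smul]
  rw [integral_finsetSum _ fun i _ => integrable_dirichletKernel_smul i x (hF.integrable N),
    fejerMean]
  congr 1
  exact Finset.sum_congr rfl fun i hi =>
    partialSum_eq_integral hF ((Finset.mem_Icc.1 hi).2.trans hn) x

theorem measurable_fejerMean (F : ℕ → DyadicGroup → 𝕜) (n : ℕ) : Measurable (fejerMean F n) :=
  Measurable.const_mul (Finset.measurable_fun_sum _ fun _ _ =>
    Finset.measurable_fun_sum _ fun i _ => (measurable_walsh i).smul_const _) _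

/-- The square root of the norm of a function: `H_{1/2}` estimates for `F` are `L_1` estimates
for the process `sqrtNorm (F n)`. -/
noncomputable def sqrtNorm {Ω E : Type*} [ENorm E] (f : Ω → E) (x : Ω) : ℝ≥0∞ :=
  ‖f x‖ₑ ^ (1 / 2 : ℝ)

theorem sqrtNorm_sq {Ω E : Type*} [ENorm E] (f : Ω → E) (x : Ω) : sqrtNorm f x ^ 2 = ‖f x‖ₑ := by
  rw [sqrtNorm, ← ENNReal.rpow_natCast, ← ENNReal.rpow_mul]; norm_num

theorem adapted_sqrtNorm {Ω E : Type*} [NormedAddCommGroup E] [NormedSpace ℝ E] [CompleteSpace E]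
    {mΩ : MeasurableSpace Ω} {μ : Measure Ω} {ℱ : Filtration ℕ mΩ} {F : ℕ → Ω → E}
    (hF : Martingale F ℱ μ) : Adapted ℱ fun n => sqrtNorm (F n) :=
  fun n => (hF.stronglyMeasurable n).enorm.pow_const _

theorem enorm_fejerMean_le {F : ℕ → DyadicGroup → 𝕜}
    (hF : Martingale F dyadicFiltration haarG) {n s : ℕ} (hsn : 2 ^ s ≤ n) (hns : n < 2 ^ (s + 1))
    (x : DyadicGroup) :
    ‖fejerMean F n x‖ₑ ≤
      (2 * ∑ i ∈ Finset.range (s + 1), shiftAvg i (sqrtNorm (F (s + 1))) x) ^ 2 := by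
  have hinv : ‖(n : 𝕜)⁻¹‖ₑ ≤ (2 ^ s)⁻¹ := by
    rw [enorm_inv (mod_cast ((Nat.two_pow_pos s).trans_le hsn).ne'), ENNReal.inv_le_inv,
      ← ofReal_norm, RCLike.norm_natCast, ENNReal.ofReal_natCast]
    exact_mod_cast hsn
  calc ‖fejerMean F n x‖ₑ
      ≤ (2 ^ s)⁻¹ * ∫⁻ y, ‖fejerSum n x y • F (s + 1) y‖ₑ ∂haarG := by
        rw [fejerMean_eq_integral hF hns.le, enorm_mul]
        exact mul_le_mul' hinv (enorm_integral_le_lintegral_enorm _)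
    _ = (2 ^ s)⁻¹ * ∫⁻ y, ‖fejerSum n x y‖ₑ * sqrtNorm (F (s + 1)) y ^ 2 ∂haarG := by
        simp only [enorm_smul, sqrtNorm_sq]
    _ ≤ (2 ^ s)⁻¹ * (2 * (2 ^ (s + 1) *
          (∑ i ∈ Finset.range (s + 1), shiftAvg i (sqrtNorm (F (s + 1))) x) ^ 2)) := by
        gcongr
        exact lintegral_enorm_fejerSum_mul_sq_le hns (adapted_sqrtNorm hF (s + 1)) x
    _ = (2 ^ s)⁻¹ * 2 ^ s *
          (2 * ∑ i ∈ Finset.range (s + 1), shiftAvg i (sqrtNorm (F (s + 1))) x) ^ 2 := by ring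
    _ = (2 * ∑ i ∈ Finset.range (s + 1), shiftAvg i (sqrtNorm (F (s + 1))) x) ^ 2 := by
        rw [ENNReal.inv_mul_cancel (by positivity) (by finiteness), one_mul]

/-! ### The maximal estimate -/

/-- The bound, uniform in `s`, for the Cesàro means `s⁻¹ ∑_{i ≤ s} shiftAvg i f` of a
`ζ_m`-measurable function `f`: the first summand takes care of the levels `i ≤ m`, the second one
of the levels `i > m`. -/
noncomputable def cesaroBound (m : ℕ) (f : DyadicGroup → ℝ≥0∞) (x : DyadicGroup) : ℝ≥0∞ :=
  3 * ((m + 1 : ℕ) : ℝ≥0∞)⁻¹ * ∑ i ∈ Finset.range (m + 1), shiftAvg i f x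
    + (1 + geomConst) * shiftAvg m f x

theorem inv_mul_sum_shiftAvg_le_cesaroBound {m s : ℕ} (hs : 1 ≤ s) (hms : m ≤ s + 1)
    {f : DyadicGroup → ℝ≥0∞} (hf : Measurable[dyadicFiltration m] f) (x : DyadicGroup) :
    (s : ℝ≥0∞)⁻¹ * ∑ i ∈ Finset.range (s + 1), shiftAvg i f x ≤ cesaroBound m f x := by
  have hinv : (s : ℝ≥0∞)⁻¹ ≤ 3 * ((m + 1 : ℕ) : ℝ≥0∞)⁻¹ := by
    rw [← div_eq_mul_inv, ENNReal.le_div_iff_mul_le (by simp) (by simp), mul_comm,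
      ← div_eq_mul_inv]
    refine ENNReal.div_le_of_le_mul ?_
    exact_mod_cast (by lia : m + 1 ≤ 3 * s)
  have hhigh : ∑ i ∈ Finset.range s, shiftAvg (m + 1 + i) f x
      ≤ s * ((1 + geomConst) * shiftAvg m f x) := by
    refine (Finset.sum_le_card_nsmul _ _ _ fun i _ => shiftAvg_le_of_le (by lia) hf x).trans_eq ?_
    rw [Finset.card_range, nsmul_eq_mul]
  calc (s : ℝ≥0∞)⁻¹ * ∑ i ∈ Finset.range (s + 1), shiftAvg i f x
      ≤ (s : ℝ≥0∞)⁻¹ * ∑ i ∈ Finset.range (m + 1 + s), shiftAvg i f x := by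
        gcongr _ * ?_
        exact Finset.sum_le_sum_of_subset (Finset.range_mono (by lia))
    _ ≤ (s : ℝ≥0∞)⁻¹ * (∑ i ∈ Finset.range (m + 1), shiftAvg i f x
          + s * ((1 + geomConst) * shiftAvg m f x)) := by
        rw [Finset.sum_range_add]
        gcongr
    _ ≤ cesaroBound m f x := by
        rw [mul_add, ← mul_assoc _ (s : ℝ≥0∞), ENNReal.inv_mul_cancel (by simp; lia) (by simp),
          one_mul, cesaroBound]
        gcongr

theorem measurable_cesaroBound (m : ℕ) (f : DyadicGroup → ℝ≥0∞) : Measurable (cesaroBound m f) :=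
  ((Finset.measurable_fun_sum _ fun i _ => measurable_shiftAvg i f).const_mul _).add
    ((measurable_shiftAvg m f).const_mul _)

theorem lintegral_cesaroBound_le (m : ℕ) {f : DyadicGroup → ℝ≥0∞} (hf : Measurable f) :
    ∫⁻ x, cesaroBound m f x ∂haarG ≤ (4 + geomConst) * geomConst * ∫⁻ x, f x ∂haarG := by
  have hQ (i : ℕ) : Measurable (shiftAvg i f) := measurable_shiftAvg i f
  have hsum : ∑ i ∈ Finset.range (m + 1), ∫⁻ x, shiftAvg i f x ∂haarG
      ≤ ((m + 1 : ℕ) : ℝ≥0∞) * (geomConst * ∫⁻ x, f x ∂haarG) := by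
    refine (Finset.sum_le_card_nsmul _ _ _ fun i _ => lintegral_shiftAvg_le i hf).trans_eq ?_
    rw [Finset.card_range, nsmul_eq_mul]
  calc ∫⁻ x, cesaroBound m f x ∂haarG
      = 3 * ((m + 1 : ℕ) : ℝ≥0∞)⁻¹ * ∑ i ∈ Finset.range (m + 1), ∫⁻ x, shiftAvg i f x ∂haarG
          + (1 + geomConst) * ∫⁻ x, shiftAvg m f x ∂haarG := by
        unfold cesaroBound
        rw [lintegral_add_right _ ((hQ m).const_mul _), lintegral_const_mul _ (hQ m),
          lintegral_const_mul _ (Finset.measurable_fun_sum _ fun i _ => hQ i),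
          lintegral_finsetSum _ fun i _ => hQ i]
    _ ≤ 3 * ((m + 1 : ℕ) : ℝ≥0∞)⁻¹ * (((m + 1 : ℕ) : ℝ≥0∞) * (geomConst * ∫⁻ x, f x ∂haarG))
          + (1 + geomConst) * (geomConst * ∫⁻ x, f x ∂haarG) := by
        gcongr
        exact lintegral_shiftAvg_le m hf
    _ = (4 + geomConst) * geomConst * ∫⁻ x, f x ∂haarG := by
        rw [mul_assoc 3, ← mul_assoc _⁻¹, ENNReal.inv_mul_cancel (by simp) (by simp)]
        ring

section RunningMax

variable {Ω : Type*}

/-- The running maximum `max_{i < n} u_i` of a nonnegative process. The inequality is strict, so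
that the running maximum starts from `0`. -/
noncomputable def runningMax (u : ℕ → Ω → ℝ≥0∞) (n : ℕ) (x : Ω) : ℝ≥0∞ :=
  ⨆ i, ⨆ _ : i < n, u i x

theorem monotone_runningMax (u : ℕ → Ω → ℝ≥0∞) (x : Ω) :
    Monotone fun n => runningMax u n x :=
  fun _ _ h => biSup_mono fun _ hi => hi.trans_le h

/-- The increments of the running maximum of a nonnegative process. They decompose the maximal
function of an adapted process into a series of nonnegative functions, the `m`-th of which is
measurable at time `m`. -/
noncomputable def maxIncrement (u : ℕ → Ω → ℝ≥0∞) (m : ℕ) (x : Ω) : ℝ≥0∞ :=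
  runningMax u (m + 1) x - runningMax u m x

theorem sum_maxIncrement (u : ℕ → Ω → ℝ≥0∞) (n : ℕ) (x : Ω) :
    ∑ m ∈ Finset.range n, maxIncrement u m x = runningMax u n x := by
  induction n with
  | zero => simp [runningMax]
  | succ n ih =>
    rw [Finset.sum_range_succ, ih, maxIncrement,
      add_tsub_cancel_of_le (monotone_runningMax u x n.le_succ)]

theorem le_sum_maxIncrement (u : ℕ → Ω → ℝ≥0∞) (n : ℕ) (x : Ω) :
    u n x ≤ ∑ m ∈ Finset.range (n + 1), maxIncrement u m x := by
  rw [sum_maxIncrement]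
  exact le_iSup₂ (f := fun i _ => u i x) n n.lt_succ_self

theorem tsum_maxIncrement_le (u : ℕ → Ω → ℝ≥0∞) (x : Ω) :
    ∑' m, maxIncrement u m x ≤ ⨆ n, u n x :=
  ENNReal.tsum_le_of_sum_range_le fun n =>
    (sum_maxIncrement u n x).trans_le (iSup₂_le fun i _ => le_iSup (fun i => u i x) i)

theorem measurable_maxIncrement {mΩ : MeasurableSpace Ω} {ℱ : Filtration ℕ mΩ}
    {u : ℕ → Ω → ℝ≥0∞} (hu : Adapted ℱ u) (m : ℕ) : Measurable[ℱ m] (maxIncrement u m) := by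
  have hmax : ∀ n ≤ m + 1, Measurable[ℱ m] (runningMax u n) := fun n hn =>
    Measurable.iSup fun i => Measurable.iSup fun hi => hu.measurable_le (by lia)
  exact (hmax (m + 1) le_rfl).sub (hmax m m.le_succ)

end RunningMax

/-- The integrable function that bounds all Cesàro means `s⁻¹ ∑_{i ≤ s} shiftAvg i (u_{s+1})`,
obtained by decomposing the running maximum of `u` into its increments. -/
noncomputable def maximalBound (u : ℕ → DyadicGroup → ℝ≥0∞) (x : DyadicGroup) : ℝ≥0∞ :=
  ∑' m : ℕ, cesaroBound m (maxIncrement u m) x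

theorem inv_mul_sum_shiftAvg_le_maximalBound {u : ℕ → DyadicGroup → ℝ≥0∞}
    (hu : Adapted dyadicFiltration u) {s : ℕ} (hs : 1 ≤ s) (x : DyadicGroup) :
    (s : ℝ≥0∞)⁻¹ * ∑ i ∈ Finset.range (s + 1), shiftAvg i (u (s + 1)) x ≤ maximalBound u x := by
  have hδ := measurable_maxIncrement hu
  calc (s : ℝ≥0∞)⁻¹ * ∑ i ∈ Finset.range (s + 1), shiftAvg i (u (s + 1)) x
      ≤ (s : ℝ≥0∞)⁻¹ * ∑ i ∈ Finset.range (s + 1), ∑ m ∈ Finset.range (s + 2),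
          shiftAvg i (maxIncrement u m) x := by
        gcongr with i
        rw [← shiftAvg_finset_sum i _ fun m => (hδ m).mono (dyadicFiltration.le m) le_rfl]
        exact shiftAvg_mono i (le_sum_maxIncrement u (s + 1)) x
    _ = ∑ m ∈ Finset.range (s + 2),
          (s : ℝ≥0∞)⁻¹ * ∑ i ∈ Finset.range (s + 1), shiftAvg i (maxIncrement u m) x := by
        rw [Finset.sum_comm, Finset.mul_sum]
    _ ≤ ∑ m ∈ Finset.range (s + 2), cesaroBound m (maxIncrement u m) x :=
        Finset.sum_le_sum fun m hm => inv_mul_sum_shiftAvg_le_cesaroBound hs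
          (Finset.mem_range_succ_iff.1 hm) (hδ m) x
    _ ≤ maximalBound u x := ENNReal.sum_le_tsum _

theorem lintegral_maximalBound_le {u : ℕ → DyadicGroup → ℝ≥0∞}
    (hu : Adapted dyadicFiltration u) :
    ∫⁻ x, maximalBound u x ∂haarG ≤
      (4 + geomConst) * geomConst * ∫⁻ x, ⨆ n, u n x ∂haarG := by
  have hδ (m : ℕ) : Measurable (maxIncrement u m) :=
    (measurable_maxIncrement hu m).mono (dyadicFiltration.le m) le_rfl
  calc ∫⁻ x, maximalBound u x ∂haarG
      = ∑' m, ∫⁻ x, cesaroBound m (maxIncrement u m) x ∂haarG :=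
        lintegral_tsum fun m => (measurable_cesaroBound m _).aemeasurable
    _ ≤ ∑' m, (4 + geomConst) * geomConst * ∫⁻ x, maxIncrement u m x ∂haarG :=
        ENNReal.tsum_le_tsum fun m => lintegral_cesaroBound_le m (hδ m)
    _ = (4 + geomConst) * geomConst * ∫⁻ x, ∑' m, maxIncrement u m x ∂haarG := by
        rw [ENNReal.tsum_mul_left, lintegral_tsum fun m => (hδ m).aemeasurable]
    _ ≤ (4 + geomConst) * geomConst * ∫⁻ x, ⨆ n, u n x ∂haarG := by
        gcongr with x
        exact tsum_maxIncrement_le u x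

/-- The weighted maximal operator `F ↦ sup_{n ≥ 2} |σ_n F| / log² n` over all Fejér means, with
values in `[0, ∞]`. -/
noncomputable def fejerMaximal (F : ℕ → DyadicGroup → 𝕜) (x : DyadicGroup) : ℝ≥0∞ :=
  ⨆ n : ℕ, ⨆ _ : 2 ≤ n, ENNReal.ofReal (‖fejerMean F n x‖ / Real.log n ^ 2)

theorem ofReal_norm_div_log_sq_le {E : Type*} [SeminormedAddGroup E] (v : E) {n s : ℕ}
    (hs : 1 ≤ s) (hsn : 2 ^ s ≤ n) :
    ENNReal.ofReal (‖v‖ / Real.log n ^ 2) ≤ (2 * (s : ℝ≥0∞)⁻¹) ^ 2 * ‖v‖ₑ := by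
  have hs' : (0 : ℝ) < s := mod_cast hs
  have hlog : (s : ℝ) / 2 ≤ Real.log n :=
    calc (s : ℝ) / 2 ≤ s * Real.log 2 := by nlinarith [Real.log_two_gt_d9]
      _ = Real.log (2 ^ s) := (Real.log_pow 2 s).symm
      _ ≤ Real.log n := Real.log_le_log (by positivity) (mod_cast hsn)
  calc ENNReal.ofReal (‖v‖ / Real.log n ^ 2)
      ≤ ENNReal.ofReal (‖v‖ / ((s : ℝ) / 2) ^ 2) := by gcongr
    _ = ENNReal.ofReal ((2 * (s : ℝ)⁻¹) ^ 2 * ‖v‖) := by congr 1; field_simp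
    _ = (2 * (s : ℝ≥0∞)⁻¹) ^ 2 * ‖v‖ₑ := by
        rw [ENNReal.ofReal_mul (by positivity), ENNReal.ofReal_pow (by positivity),
          ENNReal.ofReal_mul zero_le_two, ENNReal.ofReal_inv_of_pos hs', ENNReal.ofReal_natCast,
          ENNReal.ofReal_ofNat, ofReal_norm]

theorem fejerMaximal_le_sq {F : ℕ → DyadicGroup → 𝕜} (hF : Martingale F dyadicFiltration haarG)
    (x : DyadicGroup) :
    fejerMaximal F x ≤ (4 * maximalBound (fun n => sqrtNorm (F n)) x) ^ 2 := by
  refine iSup₂_le fun n hn => ?_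
  set s := Nat.log 2 n
  have hs : 1 ≤ s := Nat.log_pos one_lt_two hn
  have hsn : 2 ^ s ≤ n := Nat.pow_log_le_self 2 (by lia)
  have hns : n < 2 ^ (s + 1) := Nat.lt_pow_succ_log_self one_lt_two n
  calc ENNReal.ofReal (‖fejerMean F n x‖ / Real.log n ^ 2)
      ≤ (2 * (s : ℝ≥0∞)⁻¹) ^ 2 * ‖fejerMean F n x‖ₑ := ofReal_norm_div_log_sq_le _ hs hsn
    _ ≤ (2 * (s : ℝ≥0∞)⁻¹) ^ 2 *
          (2 * ∑ i ∈ Finset.range (s + 1), shiftAvg i (sqrtNorm (F (s + 1))) x) ^ 2 := by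
        gcongr
        exact enorm_fejerMean_le hF hsn hns x
    _ = (4 * ((s : ℝ≥0∞)⁻¹ *
          ∑ i ∈ Finset.range (s + 1), shiftAvg i (sqrtNorm (F (s + 1))) x)) ^ 2 := by ring
    _ ≤ (4 * maximalBound (fun n => sqrtNorm (F n)) x) ^ 2 := by
        gcongr
        exact inv_mul_sum_shiftAvg_le_maximalBound (adapted_sqrtNorm hF) hs x

theorem eLpNorm_one_half {α E : Type*} [MeasurableSpace α] [TopologicalSpace E]
    [ContinuousENorm E] (f : α → E) (μ : Measure α) :
    eLpNorm f (1 / 2) μ = (∫⁻ x, ‖f x‖ₑ ^ (1 / 2 : ℝ) ∂μ) ^ 2 := by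
  have h : (1 / 2 : ℝ≥0∞).toReal = 1 / 2 := by simp
  rw [eLpNorm_eq_lintegral_rpow_enorm_toReal (by simp) (by simp), h, one_div_one_div,
    ← ENNReal.rpow_natCast, Nat.cast_ofNat]

theorem eLpNorm_fejerMaximal_le {F : ℕ → DyadicGroup → 𝕜}
    (hF : Martingale F dyadicFiltration haarG) :
    eLpNorm (fejerMaximal F) (1 / 2) haarG ≤
      (4 * ((4 + geomConst) * geomConst)) ^ 2 * hardyNorm (1 / 2) F := by
  rw [hardyNorm, eLpNorm_one_half, eLpNorm_one_half, ← mul_pow]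
  simp only [enorm_eq_self]
  gcongr
  calc ∫⁻ x, fejerMaximal F x ^ (1 / 2 : ℝ) ∂haarG
      ≤ ∫⁻ x, 4 * maximalBound (fun n => sqrtNorm (F n)) x ∂haarG := by
        refine lintegral_mono fun x => ?_
        refine (ENNReal.rpow_le_rpow (fejerMaximal_le_sq hF x) (by norm_num)).trans_eq ?_
        rw [← ENNReal.rpow_natCast, ← ENNReal.rpow_mul]
        norm_num
    _ ≤ 4 * ((4 + geomConst) * geomConst * ∫⁻ x, ⨆ n, sqrtNorm (F n) x ∂haarG) := by
        rw [lintegral_const_mul' _ _ (by simp)]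
        gcongr
        exact lintegral_maximalBound_le (adapted_sqrtNorm hF)
    _ ≤ 4 * ((4 + geomConst) * geomConst) * ∫⁻ x, (⨆ n, ‖F n x‖ₑ) ^ (1 / 2 : ℝ) ∂haarG := by
        rw [← mul_assoc]
        gcongr with x
        refine iSup_le fun n => ?_
        unfold sqrtNorm
        gcongr
        exact le_iSup (fun n => ‖F n x‖ₑ) n

theorem measurable_fejerMaximal (F : ℕ → DyadicGroup → 𝕜) : Measurable (fejerMaximal F) :=
  Measurable.iSup fun n => Measurable.iSup fun _ =>
    ((measurable_fejerMean F n).norm.div_const _).ennreal_ofReal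

theorem measurable_weightedMaximal (F : ℕ → DyadicGroup → 𝕜) : Measurable (weightedMaximal F) :=
  Measurable.iSup fun s => Measurable.iSup fun k => Measurable.iSup fun _ =>
    ((measurable_fejerMean F (alpha s k)).norm.div_const _).ennreal_ofReal

theorem two_le_alpha {s k : ℕ} (h : k < s) : 2 ≤ alpha s k :=
  (Nat.le_self_pow (by lia) 2).trans (Nat.le_add_right _ _)

theorem weightedMaximal_le_fejerMaximal (F : ℕ → DyadicGroup → 𝕜) (x : DyadicGroup) :
    weightedMaximal F x ≤ fejerMaximal F x :=
  iSup_le fun s => iSup₂_le fun k hk =>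
    le_iSup₂ (f := fun n (_ : 2 ≤ n) => ENNReal.ofReal (‖fejerMean F n x‖ / Real.log n ^ 2))
      (alpha s k) (two_le_alpha hk)

end WalshFejer

theorem corollary3_general (𝕜 : Type*) [RCLike 𝕜] :
    ∃ c : ℝ≥0, ∀ F : ℕ → WalshFejer.DyadicGroup → 𝕜, WalshFejer.MemHardy (1 / 2) F →
      MemLp (WalshFejer.fejerMaximal F) (1 / 2) WalshFejer.haarG ∧
      eLpNorm (WalshFejer.fejerMaximal F) (1 / 2) WalshFejer.haarG
        ≤ c * WalshFejer.hardyNorm (1 / 2) F := by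
  have hfin : (4 * ((4 + WalshFejer.geomConst) * WalshFejer.geomConst)) ^ 2 ≠ ∞ := by
    have := WalshFejer.geomConst_ne_top
    finiteness
  lift (4 * ((4 + WalshFejer.geomConst) * WalshFejer.geomConst)) ^ 2 to ℝ≥0 using hfin with c hc
  refine ⟨c, fun F ⟨hmart, hnorm⟩ => ?_⟩
  have hbound := hc ▸ WalshFejer.eLpNorm_fejerMaximal_le hmart
  exact ⟨⟨(WalshFejer.measurable_fejerMaximal F).aestronglyMeasurable,
    hbound.trans_lt (ENNReal.mul_lt_top ENNReal.coe_lt_top hnorm)⟩, hbound⟩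

theorem corollary3 (𝕜 : Type*) [RCLike 𝕜] :
    ∃ c : ℝ≥0, ∀ F : ℕ → WalshFejer.DyadicGroup → 𝕜, WalshFejer.MemHardy (1 / 2) F →
      MemLp (WalshFejer.weightedMaximal F) (1 / 2) WalshFejer.haarG ∧
      eLpNorm (WalshFejer.weightedMaximal F) (1 / 2) WalshFejer.haarG
        ≤ c * WalshFejer.hardyNorm (1 / 2) F := by
  obtain ⟨c, hc⟩ := corollary3_general 𝕜
  have hle := WalshFejer.weightedMaximal_le_fejerMaximal (𝕜 := 𝕜)
  exact ⟨c, fun F hF => ⟨(hc F hF).1.of_le_enorm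
    (WalshFejer.measurable_weightedMaximal F).aestronglyMeasurable (ae_of_all _ (hle F)),
    (eLpNorm_mono_enorm (hle F)).trans (hc F hF).2⟩⟩
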